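/- Let $\mathcal D=|\mathcal N(0,1)|$ be the standard half-normal distribution and let $\mathcal D_{k:k}$ be the maximum of $k$ i.i.d. samples from $\mathcal D$. There are $n$ boxes; box $i$ has a reward $X_i\sim\mathcal D$ and an observation $Y_i=X_i+\varepsilon_i$ with $\varepsilon_i\sim\mathcal N(0,\sigma_i^2)$, where all $X_i,\varepsilon_i$ are independent (for $\sigma_i=0$, $\varepsilon_i=0$). The optimal clairvoyant policy selects a box $i$ with the largest posterior mean $\mathbb E[X_i\mid Y_i=y_i]$; its expected reward is $$R_{\mathsf{Opt}}(\boldsymbol\sigma)=\mathbb E_{\boldsymbol y}\Big[\max_{1\le i\le n}\mathbb E[X_i\mid Y_i=y_i]\Big].$$ For $c\in[1/n,1]$ with $cn>1$, let the large-noise set consist of all $\boldsymbol\sigma$ with $0\le\sigma_1\le\dots\le\sigma_n$ and $$\sigma_{m}>\frac{\mathbb E[\mathcal D_{m:m}]\,\sqrt{\ln n}}{\ln(cn)},\qquad m=\lfloor cn\rfloor ;$$ for $cn=1$ the threshold is $+\infty$ and the set is empty. Theorem. The distribution $\mathcal D$ has monotone hazard rate, that is, $(1-F(x))/f(x)$ is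 non-increasing, where $F$ is its distribution function and $f$ its density, and $\mathbb E[\mathcal D_{k:k}]=\omega(\mathbb E[\mathcal D])$ as $k\to\infty$. Moreover, there is an integer $n_0$ such that the following two statements hold. (a) There is an absolute constant $K>0$ such that for all $n\ge n_0$, all $c\in[1/n,1]$ with $cn\notin(1,2)$ (in particular, all $c\in[1/n,1]$ for which $cn$ is an integer) and all $\boldsymbol\sigma$ in the large-noise set, $$R_{\mathsf{Opt}}(\boldsymbol\sigma)\le K\sqrt{\ln(cn)}\;\mathbb E[\mathcal D].$$ (b) For every real $M$ there is a constant $K_M>0$ such that, for all $n$, $c$, $\boldsymbol\sigma$ as in (a) with $cn\le M$, $$R_{\mathsf{Rand}}\le R_{\mathsf{Opt}}(\boldsymbol\sigma)\le K_M\,R_{\mathsf{Rand}},$$ where $R_{\mathsf{Rand}}$ is the expected reward from a box chosen uniformly at random. -/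

import Mathlib

open MeasureTheory ProbabilityTheory Filter Asymptotics Set
open scoped NNReal ENNReal

noncomputable section

/-- The standard half-normal distribution `|N(0,1)|`. -/
def halfNormal : Measure ℝ := (gaussianReal 0 1).map (fun x => |x|)

instance : IsProbabilityMeasure halfNormal :=
  Measure.isProbabilityMeasure_map (by fun_prop)

/-- Monotone hazard rate: `D` has a density `f` such that `(1 - F(x)) / f(x)` is non-increasing.
The quotient is taken in `[0, ∞]`, so it is `∞` where `f` vanishes to the left of (or inside)
the support, and `0` to the right of the support. -/
def IsMHR (D : Measure ℝ) : Prop :=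
  ∃ f : ℝ → ℝ≥0, Measurable f ∧ D = volume.withDensity (fun x => (f x : ℝ≥0∞)) ∧
    Antitone (fun x : ℝ => D (Ioi x) / (f x : ℝ≥0∞))

/-- `E[D]`. -/
def mean (D : Measure ℝ) : ℝ := ∫ x, x ∂D

/-- `E[D_{k:k}]`, the expected maximum of `k` i.i.d. samples from `D`. -/
def expMax (D : Measure ℝ) [IsProbabilityMeasure D] (k : ℕ) : ℝ :=
  ∫ x : Fin k → ℝ, (⨆ i, x i) ∂(Measure.pi fun _ => D)

/-- The joint law of the reward and the noise `(X, ε)` of one box whose noise has standard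
deviation `s`: `X ∼ D` and `ε ∼ N(0, s²)` are independent. -/
def boxLaw (D : Measure ℝ) (s : ℝ≥0) : Measure (ℝ × ℝ) := D.prod (gaussianReal 0 (s ^ 2))

instance (D : Measure ℝ) [IsProbabilityMeasure D] (s : ℝ≥0) :
    IsProbabilityMeasure (boxLaw D s) := by
  unfold boxLaw; infer_instance

/-- The law of the observation `Y = X + ε` of one box. -/
def obsLaw (D : Measure ℝ) (s : ℝ≥0) : Measure ℝ := (boxLaw D s).map (fun p => p.1 + p.2)

instance (D : Measure ℝ) [IsProbabilityMeasure D] (s : ℝ≥0) :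
    IsProbabilityMeasure (obsLaw D s) :=
  Measure.isProbabilityMeasure_map (by fun_prop)

/-- The posterior mean `E[X | Y = y]` of one box: the mean of the regular conditional
distribution of `X` given `Y = X + ε`, at `Y = y`. -/
def posteriorMean (D : Measure ℝ) [IsProbabilityMeasure D] (s : ℝ≥0) (y : ℝ) : ℝ :=
  ∫ x, x ∂(condDistrib (fun p : ℝ × ℝ => p.1) (fun p : ℝ × ℝ => p.1 + p.2) (boxLaw D s) y)

/-- The expected reward of the optimal clairvoyant policy, which selects a box `i` maximizing
`E[X_i | Y_i = y_i]`, that is `E_y [max_i E[X_i | Y_i = y_i]]`. -/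
def optReward (D : Measure ℝ) [IsProbabilityMeasure D] {n : ℕ} (σ : Fin n → ℝ≥0) : ℝ :=
  ∫ y : Fin n → ℝ, (⨆ i, posteriorMean D (σ i) (y i)) ∂(Measure.pi fun i => obsLaw D (σ i))

/-- The expected reward from selecting one of `n` boxes uniformly at random. -/
def randomReward (D : Measure ℝ) [IsProbabilityMeasure D] (n : ℕ) : ℝ :=
  ∫ x : Fin n → ℝ, (∑ i, (1 / (n : ℝ)) * x i) ∂(Measure.pi fun _ => D)

/-- The large-noise set: vectors `0 ≤ σ_1 ≤ … ≤ σ_n` with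
`σ_{cn} > E[D_{cn:cn}] √(ln n) / ln(cn)`, where `cn` is rounded down when it is used as an index.
For `cn = 1` the threshold is `+∞`, so that the set is empty. -/
def largeNoise (D : Measure ℝ) [IsProbabilityMeasure D] (n : ℕ) (c : ℝ) : Set (Fin n → ℝ≥0) :=
  {σ | Monotone σ ∧ 1 < c * n ∧ ∃ i : Fin n, (i : ℕ) + 1 = ⌊c * n⌋₊ ∧
    expMax D ⌊c * n⌋₊ * √(Real.log n) / Real.log (c * n) < (σ i : ℝ)}

end

/-! Given `Y = y`, the reward of a box with noise `s` is `N(y/(1+s²), s²/(1+s²))` conditioned to be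
positive. That variance is at most 1, so the posterior mean is at most `1 + max (y/(1+s²)) 0`
(`posteriorMean_le_ae`). Since `Y` has Gaussian-type exponential moments with variance `1+s²`, the
quantity `y/(1+s²)` fluctuates on the scale `1/√(1+s²)`: large noise shrinks the posterior mean
towards a constant.

The maximum over boxes is then controlled by a union bound with a separate exponential tilt for each
box (`optReward_halfNormal_le`). Put `m = ⌊cn⌋`. The `m - 1` boxes before the `m`-th may have any
noise and cost `O(√log m)`, as a maximum of `m` variables does. The others have noise at least `t =
E[D_{m:m}] √log n / log(cn)`, so their maximum costs `O(√log n / t) = O(log(cn) / E[D_{m:m}])`. This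
is `O(√log(cn))` because `E[D_{m:m}] ≥ a √log m` (`expMax_halfNormal_lower`). That lower bound also
shows that the mean is negligible against the expected maximum.

For bounded `cn` this is a constant multiple of the mean, which is the random reward. The reverse
inequality holds because the maximum dominates the posterior mean of any fixed box. -/

/-! ### Density and hazard rate of the half-normal law -/

/-- The integral of an even function is twice its integral over the half-line. -/
theorem lintegral_even {g : ℝ → ℝ≥0∞} (hg : ∀ x, g (-x) = g x) :
    ∫⁻ x, g x = 2 * ∫⁻ x in Ioi 0, g x := by
  have h1 : ∫⁻ x in Iic 0, g x = ∫⁻ x in Ioi 0, g x := by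
    rw [← setLIntegral_congr (Iio_ae_eq_Iic (a := (0 : ℝ)) (μ := volume))]
    have := (Measure.measurePreserving_neg (volume : Measure ℝ)).setLIntegral_comp_preimage_emb
      (MeasurableEquiv.neg ℝ).measurableEmbedding g (Iio 0)
    simpa [hg] using this.symm
  rw [← lintegral_add_compl g (measurableSet_Ioi (a := (0 : ℝ))), compl_Ioi, h1, two_mul]

/-- The density of the half-normal distribution. -/
noncomputable def halfNormalDensity (x : ℝ) : ℝ≥0 :=
  if 0 < x then 2 * (gaussianPDFReal 0 1 x).toNNReal else 0

theorem measurable_halfNormalDensity : Measurable halfNormalDensity := by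
  unfold halfNormalDensity
  exact Measurable.ite measurableSet_Ioi
    ((measurable_gaussianPDFReal 0 1).real_toNNReal.const_mul 2) measurable_const

theorem coe_halfNormalDensity_of_pos {x : ℝ} (hx : 0 < x) :
    (halfNormalDensity x : ℝ≥0∞) = 2 * gaussianPDF 0 1 x := by
  simp [halfNormalDensity, hx, gaussianPDF, ENNReal.ofReal]

theorem lintegral_halfNormal {g : ℝ → ℝ≥0∞} (hg : Measurable g) :
    ∫⁻ x, g x ∂halfNormal = ∫⁻ x in Ioi 0, 2 * gaussianPDF 0 1 x * g x := by
  rw [halfNormal, lintegral_map hg (by fun_prop), gaussianReal_of_var_ne_zero _ one_ne_zero,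
    lintegral_withDensity_eq_lintegral_mul _ (measurable_gaussianPDF 0 1) (by fun_prop),
    lintegral_even (by intro x; simp [gaussianPDF, gaussianPDFReal]),
    ← lintegral_const_mul' _ _ (by simp)]
  refine setLIntegral_congr_fun measurableSet_Ioi fun x (hx : 0 < x) => ?_
  simp [abs_of_pos hx, mul_assoc]

theorem lintegral_halfNormalDensity_mul (g : ℝ → ℝ≥0∞) :
    ∫⁻ x, halfNormalDensity x * g x = ∫⁻ x in Ioi 0, 2 * gaussianPDF 0 1 x * g x := by
  rw [← lintegral_indicator measurableSet_Ioi]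
  refine lintegral_congr fun x => ?_
  by_cases hx : 0 < x
  · rw [indicator_of_mem (mem_Ioi.2 hx), coe_halfNormalDensity_of_pos hx]
  · rw [indicator_of_notMem (by simpa using hx)]
    simp [halfNormalDensity, hx]

theorem halfNormal_eq_withDensity :
    halfNormal = volume.withDensity (fun x => (halfNormalDensity x : ℝ≥0∞)) := by
  refine Measure.ext_of_lintegral _ fun g hg => ?_
  rw [lintegral_halfNormal hg, lintegral_withDensity_eq_lintegral_mul _
    measurable_halfNormalDensity.coe_nnreal_ennreal hg]
  exact (lintegral_halfNormalDensity_mul g).symm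

theorem halfNormal_ae_pos : ∀ᵐ x ∂halfNormal, 0 < x := by
  have : halfNormal (Iic 0) = 0 := by
    rw [← lintegral_indicator_one measurableSet_Iic,
      lintegral_halfNormal (measurable_one.indicator measurableSet_Iic)]
    rw [setLIntegral_congr_fun (g := fun _ => 0) measurableSet_Ioi]
    · simp
    · intro x (hx : 0 < x)
      simp [hx]
  rw [ae_iff]
  simpa [Iic, not_lt] using this

theorem gaussianPDF_add (x u : ℝ) :
    gaussianPDF 0 1 (u + x) = gaussianPDF 0 1 x * ENNReal.ofReal (Real.exp (-(x * u) - u ^ 2 / 2)) := by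
  rw [gaussianPDF, gaussianPDF, ← ENNReal.ofReal_mul (gaussianPDFReal_nonneg _ _ _)]
  congr 1
  simp only [gaussianPDFReal, mul_assoc, ← Real.exp_add]
  congr 2
  push_cast
  ring_nf

/-- Substituting `y = u + x` and expanding the square pulls the density at `x` out of the tail. The
remaining integral is the inverse hazard rate, visibly decreasing in `x`. -/
theorem halfNormal_Ioi {x : ℝ} (hx : 0 ≤ x) :
    halfNormal (Ioi x) = 2 * gaussianPDF 0 1 x *
      ∫⁻ u in Ioi 0, ENNReal.ofReal (Real.exp (-(x * u) - u ^ 2 / 2)) := by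
  have h1 : halfNormal (Ioi x) = ∫⁻ y in Ioi x, 2 * gaussianPDF 0 1 y := by
    rw [← lintegral_indicator_one measurableSet_Ioi,
      lintegral_halfNormal (measurable_one.indicator measurableSet_Ioi),
      ← lintegral_indicator measurableSet_Ioi, ← lintegral_indicator measurableSet_Ioi]
    refine lintegral_congr fun y => ?_
    by_cases hy : x < y
    · simp [hy, hx.trans_lt hy]
    · simp [indicator, hy]
  have h2 := (measurePreserving_add_right (volume : Measure ℝ) x).setLIntegral_comp_preimage_emb
      (measurableEmbedding_addRight x) (fun y => 2 * gaussianPDF 0 1 y) (Ioi x)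
  rw [h1, ← h2, ← lintegral_const_mul' _ _ (ENNReal.mul_ne_top (by simp) gaussianPDF_lt_top.ne)]
  simp [gaussianPDF_add, mul_assoc]

theorem isMHR_halfNormal : IsMHR halfNormal := by
  refine ⟨halfNormalDensity, measurable_halfNormalDensity, halfNormal_eq_withDensity, ?_⟩
  have key : ∀ x : ℝ, 0 < x → halfNormal (Ioi x) / (halfNormalDensity x : ℝ≥0∞) =
      ∫⁻ u in Ioi 0, ENNReal.ofReal (Real.exp (-(x * u) - u ^ 2 / 2)) := by
    intro x hx
    rw [halfNormal_Ioi hx.le, coe_halfNormalDensity_of_pos hx, mul_comm (2 * gaussianPDF 0 1 x)]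
    refine ENNReal.mul_div_cancel_right ?_ (ENNReal.mul_ne_top (by simp) gaussianPDF_lt_top.ne)
    exact mul_ne_zero two_ne_zero (gaussianPDF_pos 0 one_ne_zero x).ne'
  intro x y hxy
  dsimp only
  by_cases hx : 0 < x
  · rw [key x hx, key y (hx.trans_le hxy)]
    refine setLIntegral_mono' measurableSet_Ioi fun u (hu : 0 < u) => ?_
    gcongr
  -- The density vanishes here, so the quotient is `∞` only because the tail is nonzero; in `ℝ≥0∞`,
  -- `0 / 0` would be `0`.
  · have hpos : halfNormal (Ioi x) ≠ 0 := by
      have : halfNormal (Ioi 0) = 1 := by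
        rw [prob_compl_eq_zero_iff measurableSet_Ioi |>.symm]
        simpa [ae_iff, compl_def] using halfNormal_ae_pos
      exact ((by simp [this] : (0 : ℝ≥0∞) < halfNormal (Ioi 0)).trans_le
        (measure_mono (Ioi_subset_Ioi (not_lt.1 hx)))).ne'
    have : (halfNormalDensity x : ℝ≥0∞) = 0 := by simp [halfNormalDensity, hx]
    rw [this, ENNReal.div_zero hpos]
    exact le_top

/-! ### Moments of the half-normal law -/

theorem integrable_exp_mul_halfNormal (t : ℝ) :
    Integrable (fun x => Real.exp (t * x)) halfNormal := by
  rw [halfNormal, integrable_map_measure (by fun_prop) (by fun_prop)]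
  refine ((integrable_exp_mul_gaussianReal t).add (integrable_exp_mul_gaussianReal (-t))).mono'
    (by fun_prop) (ae_of_all _ fun x => ?_)
  rcases abs_choice x with h | h <;>
    simp [h, Real.exp_nonneg]

theorem integral_exp_mul_gaussianReal (v : ℝ≥0) (t : ℝ) :
    ∫ x, Real.exp (t * x) ∂(gaussianReal 0 v) = Real.exp (v * t ^ 2 / 2) := by
  have := mgf_gaussianReal (p := gaussianReal 0 v) (X := id) (μ := 0) (v := v) (by simp) t
  simpa [mgf] using this

theorem integral_exp_mul_halfNormal_le (t : ℝ) :
    ∫ x, Real.exp (t * x) ∂halfNormal ≤ 2 * Real.exp (t ^ 2 / 2) := by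
  rw [halfNormal, integral_map (by fun_prop) (by fun_prop)]
  calc ∫ x, Real.exp (t * |x|) ∂(gaussianReal 0 1)
      ≤ ∫ x, (Real.exp (t * x) + Real.exp (-t * x)) ∂(gaussianReal 0 1) := by
        refine integral_mono_of_nonneg (ae_of_all _ fun x => (Real.exp_pos _).le)
          ((integrable_exp_mul_gaussianReal t).add (integrable_exp_mul_gaussianReal (-t)))
          (ae_of_all _ fun x => ?_)
        rcases abs_choice x with h | h <;> simp [h, Real.exp_nonneg]
    _ = 2 * Real.exp (t ^ 2 / 2) := by
        rw [integral_add (integrable_exp_mul_gaussianReal t) (integrable_exp_mul_gaussianReal (-t)),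
          integral_exp_mul_gaussianReal, integral_exp_mul_gaussianReal]
        simp [two_mul]

theorem integrable_id_halfNormal : Integrable (fun x : ℝ => x) halfNormal := by
  refine (integrable_exp_mul_halfNormal 1).mono' (by fun_prop) ?_
  filter_upwards [halfNormal_ae_pos] with x hx
  rw [Real.norm_of_nonneg hx.le, one_mul]
  linarith [Real.add_one_le_exp x]

theorem mean_halfNormal_pos : 0 < mean halfNormal := by
  rw [mean, integral_pos_iff_support_of_nonneg_ae (halfNormal_ae_pos.mono fun x hx => hx.le)
    integrable_id_halfNormal]
  have : halfNormal (Function.support fun x : ℝ => x) = 1 := by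
    rw [← mem_ae_iff_prob_eq_one (measurableSet_support (f := fun x : ℝ => x) measurable_id)]
    exact halfNormal_ae_pos.mono fun x hx => hx.ne'
  simp [this]

theorem randomReward_eq_mean {D : Measure ℝ} [IsProbabilityMeasure D]
    (hD : Integrable (fun x : ℝ => x) D) {n : ℕ} (hn : n ≠ 0) : randomReward D n = mean D := by
  rw [randomReward, integral_finsetSum _ fun i _ =>
    (integrable_comp_eval (μ := fun _ : Fin n => D) (i := i) hD).const_mul _]
  have : ∀ i : Fin n, ∫ x : Fin n → ℝ, (1 / (n : ℝ)) * x i ∂(Measure.pi fun _ => D) =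
      1 / (n : ℝ) * mean D := by
    intro i
    rw [integral_const_mul, mean,
      integral_comp_eval (μ := fun _ : Fin n => D) (i := i) (f := fun x => x) (by fun_prop)]
  have hn' : (n : ℝ) ≠ 0 := by exact_mod_cast hn
  simp only [this, Finset.sum_const, Finset.card_univ, Fintype.card_fin, nsmul_eq_mul]
  field_simp

/-! ### Finite maxima and the growth of the expected maximum -/

theorem measurable_fin_iSup {n : ℕ} : Measurable (fun x : Fin n → ℝ => ⨆ i, x i) := by
  rcases Nat.eq_zero_or_pos n with rfl | hn
  · simp [Real.iSup_of_isEmpty]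
  · have : Nonempty (Fin n) := ⟨⟨0, hn⟩⟩
    have h : (fun x : Fin n → ℝ => ⨆ i, x i) =
        Finset.univ.sup' Finset.univ_nonempty (fun i (x : Fin n → ℝ) => x i) := by
      funext x
      rw [Finset.sup'_apply, Finset.sup'_univ_eq_ciSup]
    rw [h]
    exact Finset.measurable_sup' _ fun i _ => measurable_pi_apply i

theorem abs_fin_iSup_le {n : ℕ} (x : Fin n → ℝ) : |⨆ i, x i| ≤ ∑ i, |x i| := by
  rcases Nat.eq_zero_or_pos n with rfl | hn
  · simp [Real.iSup_of_isEmpty]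
  · have : Nonempty (Fin n) := ⟨⟨0, hn⟩⟩
    obtain ⟨i, hi⟩ := exists_eq_ciSup_of_finite (f := x)
    rw [← hi]
    exact Finset.single_le_sum (f := fun i => |x i|) (fun i _ => abs_nonneg _) (Finset.mem_univ i)

theorem integrable_fin_iSup {n : ℕ} {μ : Fin n → Measure ℝ} [∀ i, IsProbabilityMeasure (μ i)]
    {f : Fin n → ℝ → ℝ} (hf : ∀ i, Integrable (f i) (μ i)) :
    Integrable (fun x : Fin n → ℝ => ⨆ i, f i (x i)) (Measure.pi μ) := by
  have hi : ∀ i, Integrable (fun x : Fin n → ℝ => f i (x i)) (Measure.pi μ) :=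
    fun i => integrable_comp_eval (hf i)
  refine (integrable_finsetSum Finset.univ fun i _ => (hi i).abs).mono' ?_
    (ae_of_all _ fun x => abs_fin_iSup_le _)
  exact (measurable_fin_iSup.comp_aemeasurable
    (aemeasurable_pi_lambda _ fun i => (hi i).aemeasurable)).aestronglyMeasurable

theorem halfNormal_tail_lower : ∃ δ : ℝ, 0 < δ ∧ ∀ t : ℝ, 0 ≤ t →
    δ * Real.exp (-t ^ 2) ≤ (halfNormal (Ioi t)).toReal := by
  let J : ℝ≥0∞ := ∫⁻ u in Ioi (0 : ℝ), ENNReal.ofReal (Real.exp (- u ^ 2))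
  have hJ0 : J ≠ 0 := by
    intro h
    rw [lintegral_eq_zero_iff (by fun_prop)] at h
    have h2 : volume.restrict (Ioi (0 : ℝ)) = 0 := by
      rw [← ae_eq_bot, ← Filter.eventually_false_iff_eq_bot]
      filter_upwards [h] with u hu
      simp at hu
      exact absurd hu (Real.exp_pos _).not_ge
    simp at h2
  have hle : ∀ t : ℝ, 0 ≤ t → 2 * gaussianPDF 0 1 0 * J * ENNReal.ofReal (Real.exp (-t ^ 2)) ≤
      halfNormal (Ioi t) := by
    intro t ht
    rw [halfNormal_Ioi ht, gaussianPDF, gaussianPDF]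
    have : ∫⁻ u in Ioi 0, ENNReal.ofReal (Real.exp (-(t * u) - u ^ 2 / 2)) ≥
        J * ENNReal.ofReal (Real.exp (-t ^ 2 / 2)) := by
      rw [← lintegral_mul_const' _ _ (by simp)]
      refine lintegral_mono fun u => ?_
      rw [← ENNReal.ofReal_mul (Real.exp_pos _).le, ← Real.exp_add]
      gcongr
      -- The inequality `t u ≤ t²/2 + u²/2` separates the variables.
      nlinarith [sq_nonneg (t - u)]
    have h2 : gaussianPDFReal 0 1 t = gaussianPDFReal 0 1 0 * Real.exp (-t ^ 2 / 2) := by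
      simp [gaussianPDFReal]
    have h3 : Real.exp (-t ^ 2) = Real.exp (-t ^ 2 / 2) * Real.exp (-t ^ 2 / 2) := by
      rw [← Real.exp_add]; ring_nf
    rw [h2, h3, ENNReal.ofReal_mul (gaussianPDFReal_nonneg _ _ _),
      ENNReal.ofReal_mul (Real.exp_pos _).le]
    calc _ = 2 * (ENNReal.ofReal (gaussianPDFReal 0 1 0) * ENNReal.ofReal (Real.exp (-t ^ 2 / 2))) *
        (J * ENNReal.ofReal (Real.exp (-t ^ 2 / 2))) := by ring
      _ ≤ _ := by gcongr
  have hC : 2 * gaussianPDF 0 1 0 * J ≠ ∞ := by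
    have := hle 0 le_rfl
    simp at this
    exact (this.trans_lt (measure_lt_top _ _)).ne
  refine ⟨(2 * gaussianPDF 0 1 0 * J).toReal, ENNReal.toReal_pos ?_ hC, fun t ht => ?_⟩
  · exact mul_ne_zero (mul_ne_zero two_ne_zero (gaussianPDF_pos 0 one_ne_zero 0).ne') hJ0
  · have := ENNReal.toReal_mono (measure_ne_top _ _) (hle t ht)
    rwa [ENNReal.toReal_mul, ENNReal.toReal_ofReal (Real.exp_pos _).le] at this

/-- At level `t = √log k` each sample exceeds `t` with probability at least `δ/k`, so the maximum
does with probability at least `1 - (1 - δ/k)^k ≥ 1 - exp (-δ)`; Markov's inequality concludes. -/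
theorem expMax_halfNormal_lower : ∃ a : ℝ, 0 < a ∧ ∀ k : ℕ, 1 ≤ k →
    a * √(Real.log k) ≤ expMax halfNormal k := by
  obtain ⟨δ, hδ, htail⟩ := halfNormal_tail_lower
  refine ⟨1 - Real.exp (-δ), by simpa using hδ, fun k hk => ?_⟩
  have hk0 : (0 : ℝ) < k := by exact_mod_cast hk
  have hne : Nonempty (Fin k) := ⟨⟨0, hk⟩⟩
  set t := √(Real.log k) with ht
  have ht0 : 0 ≤ t := Real.sqrt_nonneg _
  set P := Measure.pi fun _ : Fin k => halfNormal with hP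
  have ht2 : Real.exp (-t ^ 2) = 1 / k := by
    rw [ht, Real.sq_sqrt (Real.log_nonneg (by exact_mod_cast hk)), Real.exp_neg,
      Real.exp_log hk0, one_div]
  set p := (halfNormal (Ioi t)).toReal with hp
  have hp1 : p ≤ 1 := measureReal_le_one
  have hlow : δ / k ≤ p := by
    have := htail t ht0
    rwa [ht2, mul_one_div] at this
  have hpow : (1 - p) ^ k ≤ Real.exp (-δ) := by
    calc (1 - p) ^ k ≤ (Real.exp (-p)) ^ k :=
          pow_le_pow_left₀ (by linarith) (Real.one_sub_le_exp_neg p) k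
      _ = Real.exp (-(k * p)) := by rw [← Real.exp_nat_mul]; ring_nf
      _ ≤ _ := by
          rw [div_le_iff₀ hk0] at hlow
          gcongr
          linarith
  have hset : {x : Fin k → ℝ | t < ⨆ i, x i} = (Set.univ.pi fun _ => Iic t)ᶜ := by
    ext x
    simp [lt_ciSup_iff (Set.finite_range x).bddAbove, Pi.le_def]
  have hprob : P.real {x : Fin k → ℝ | t < ⨆ i, x i} = 1 - (1 - p) ^ k := by
    rw [hset, probReal_compl_eq_one_sub (MeasurableSet.univ_pi fun _ => measurableSet_Iic),
      measureReal_def, hP, Measure.pi_pi]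
    simp only [Finset.prod_const, Finset.card_univ, Fintype.card_fin, ENNReal.toReal_pow]
    rw [← compl_Ioi]
    congr 2
    exact probReal_compl_eq_one_sub measurableSet_Ioi
  have hint : Integrable (fun x : Fin k → ℝ => ⨆ i, x i) P :=
    integrable_fin_iSup (f := fun _ x => x) fun _ => integrable_id_halfNormal
  have hnn : 0 ≤ᵐ[P] fun x => ⨆ i, x i := by
    have : ∀ᵐ x ∂P, ∀ i, 0 < x i := by
      rw [ae_all_iff]
      exact fun i => (measurePreserving_eval (fun _ : Fin k => halfNormal) i).quasiMeasurePreserving.ae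
        halfNormal_ae_pos
    filter_upwards [this] with x hx
    exact Real.iSup_nonneg fun i => (hx i).le
  have hmk := mul_meas_ge_le_integral_of_nonneg hnn hint t
  have hmono : P.real {x : Fin k → ℝ | t < ⨆ i, x i} ≤ P.real {x : Fin k → ℝ | t ≤ ⨆ i, x i} :=
    measureReal_mono fun x (hx : t < _) => hx.le
  calc (1 - Real.exp (-δ)) * t ≤ t * P.real {x : Fin k → ℝ | t ≤ ⨆ i, x i} := by
        rw [mul_comm]; gcongr; linarith
    _ ≤ _ := hmk

theorem mean_isLittleO_expMax_halfNormal :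
    (fun _ : ℕ => mean halfNormal) =o[atTop] (fun k : ℕ => expMax halfNormal k) := by
  obtain ⟨a, ha, h⟩ := expMax_halfNormal_lower
  refine isLittleO_const_left.2 (Or.inr ?_)
  refine tendsto_norm_atTop_atTop.comp (tendsto_atTop_mono' atTop
    ((eventually_ge_atTop 1).mono h) ?_)
  exact ((Real.tendsto_sqrt_atTop.comp Real.tendsto_log_atTop).comp
    tendsto_natCast_atTop_atTop).const_mul_atTop ha

/-! ### Means of truncated Gaussians -/

theorem integral_Ioi_sub_one_mul_gaussian_le {v : ℝ} (hv : 0 < v) (hv1 : v ≤ 1) :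
    ∫ u in Ioi (0 : ℝ), (u - 1) * Real.exp (-(1 / (2 * v)) * u ^ 2) ≤ 0 := by
  have hb : 0 < 1 / (2 * v) := by positivity
  have h1 : ∫ u in Ioi (0 : ℝ), u * Real.exp (-(1 / (2 * v)) * u ^ 2) = v := by
    have h := integral_rpow_mul_exp_neg_mul_rpow (p := 2) (q := 1) (b := 1 / (2 * v))
      two_pos (by norm_num) hb
    simp only [Real.rpow_one, Real.rpow_two] at h
    rw [h]
    norm_num [Real.rpow_neg_one]
    ring
  have h2 := integral_gaussian_Ioi (1 / (2 * v))
  have h3 : v ≤ √(Real.pi / (1 / (2 * v))) / 2 := by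
    rw [le_div_iff₀ two_pos]
    refine Real.le_sqrt_of_sq_le ?_
    have : Real.pi / (1 / (2 * v)) = 2 * Real.pi * v := by field_simp
    rw [this]
    nlinarith [Real.pi_gt_three]
  have hi1 : Integrable (fun u : ℝ => u * Real.exp (-(1 / (2 * v)) * u ^ 2)) :=
    integrable_mul_exp_neg_mul_sq hb
  have hi2 : Integrable (fun u : ℝ => Real.exp (-(1 / (2 * v)) * u ^ 2)) :=
    integrable_exp_neg_mul_sq hb
  simp only [sub_mul, one_mul]
  rw [integral_sub hi1.integrableOn hi2.integrableOn, h1, h2]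
  linarith

theorem integrable_sub_mul_gaussian {v : ℝ} (hv : 0 < v) (μ h : ℝ) :
    Integrable (fun x : ℝ => (x - h) * Real.exp (-(1 / (2 * v)) * (x - μ) ^ 2)) := by
  have hb : 0 < 1 / (2 * v) := by positivity
  have h1 := ((integrable_mul_exp_neg_mul_sq hb).add
    ((integrable_exp_neg_mul_sq hb).const_mul (μ - h))).comp_sub_right μ
  refine h1.congr (ae_of_all _ fun x => ?_)
  simp only [Pi.add_apply]
  ring

/-- The mean of `N(μ, v)` conditioned to be positive is at most `max μ 0 + 1` if `v ≤ 1`. -/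
theorem integral_Ioi_sub_mul_gaussian_le {v : ℝ} (hv : 0 < v) (hv1 : v ≤ 1) (μ : ℝ) :
    ∫ x in Ioi (0 : ℝ), (x - (1 + max μ 0)) * Real.exp (-(1 / (2 * v)) * (x - μ) ^ 2) ≤ 0 := by
  have hb : 0 < 1 / (2 * v) := by positivity
  have key := integral_Ioi_sub_one_mul_gaussian_le hv hv1
  have hint := fun h => integrable_sub_mul_gaussian hv μ h
  rcases le_total 0 μ with hμ | hμ
  -- On `(0, μ]` the integrand is nonpositive; beyond `μ`, a shift reduces to the centred case.
  · rw [max_eq_left hμ, ← Ioc_union_Ioi_eq_Ioi hμ, setIntegral_union Ioc_disjoint_Ioi_same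
      measurableSet_Ioi (hint _).integrableOn (hint _).integrableOn]
    have h1 : ∫ x in Ioc 0 μ, (x - (1 + μ)) * Real.exp (-(1 / (2 * v)) * (x - μ) ^ 2) ≤ 0 :=
      setIntegral_nonpos measurableSet_Ioc fun x hx =>
        mul_nonpos_of_nonpos_of_nonneg (by linarith [hx.2]) (Real.exp_pos _).le
    have h2 := (measurePreserving_add_right (volume : Measure ℝ) μ).setIntegral_preimage_emb
      (measurableEmbedding_addRight μ)
      (fun x => (x - (1 + μ)) * Real.exp (-(1 / (2 * v)) * (x - μ) ^ 2)) (Ioi μ)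
    have h3 : (fun x => x + μ) ⁻¹' Ioi μ = Ioi 0 := by ext; simp
    have h4 : ∀ x, x + μ - (1 + μ) = x - 1 := fun x => by ring
    simp only [h3, h4, add_sub_cancel_right] at h2
    linarith
  · rw [max_eq_right hμ, add_zero]
    have hb' : 0 ≤ -μ / v := div_nonneg (by linarith) hv.le
    have hi0 := (integrable_sub_mul_gaussian hv 0 1)
    simp only [sub_zero] at hi0
    -- For `μ ≤ 0` the weight is the centred one times a tilt decreasing in `x`. Replacing the tilt
    -- by its value at `x = 1`, where `x - 1` changes sign, only increases the integral.
    have hle : ∫ x in Ioi (0 : ℝ), (x - 1) * Real.exp (-(1 / (2 * v)) * (x - μ) ^ 2) ≤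
        ∫ x in Ioi (0 : ℝ), Real.exp (-(1 / (2 * v)) * μ ^ 2 - (-μ / v)) *
          ((x - 1) * Real.exp (-(1 / (2 * v)) * x ^ 2)) := by
      refine integral_mono (hint 1).integrableOn (hi0.const_mul _).integrableOn fun x => ?_
      have e : Real.exp (-(1 / (2 * v)) * (x - μ) ^ 2) =
          Real.exp (-(1 / (2 * v)) * x ^ 2) * Real.exp (-(1 / (2 * v)) * μ ^ 2 - (-μ / v) * x) := by
        rw [← Real.exp_add]
        congr 1
        field_simp
        ring
      dsimp only
      rw [e, show ∀ a b c d : ℝ, a * (b * c) ≤ d * (a * b) ↔ b * (a * c) ≤ b * (a * d) from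
        fun a b c d => by rw [show a * (b * c) = b * (a * c) by ring,
          show d * (a * b) = b * (a * d) by ring]]
      refine mul_le_mul_of_nonneg_left ?_ (Real.exp_pos _).le
      rcases le_total 1 x with hx | hx
      · refine mul_le_mul_of_nonneg_left (Real.exp_le_exp.2 ?_) (by linarith)
        nlinarith
      · refine mul_le_mul_of_nonpos_left (Real.exp_le_exp.2 ?_) (by linarith)
        nlinarith
    refine hle.trans ?_
    rw [integral_const_mul]
    exact mul_nonpos_of_nonneg_of_nonpos (Real.exp_pos _).le key

/-! ### The posterior mean of one box -/

/-- The upper bound for the posterior mean of a box with noise `s` at the observation `y`. -/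
noncomputable def posteriorBound (s : ℝ≥0) (y : ℝ) : ℝ := 1 + max (y / (1 + (s : ℝ) ^ 2)) 0

theorem measurable_posteriorBound (s : ℝ≥0) : Measurable (posteriorBound s) := by
  unfold posteriorBound; fun_prop

theorem one_le_posteriorBound (s : ℝ≥0) (y : ℝ) : 1 ≤ posteriorBound s y := by
  simp [posteriorBound]

/-- Completing the square in `x`: prior times likelihood is a factor free of `x` times a Gaussian
weight of mean `y/(1+s²)` and variance `s²/(1+s²)`. -/
theorem gaussianPDFReal_mul_gaussianPDFReal {s : ℝ≥0} (hs : s ≠ 0) (x y : ℝ) :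
    gaussianPDFReal 0 1 x * gaussianPDFReal x (s ^ 2) y =
      gaussianPDFReal 0 1 0 * gaussianPDFReal 0 (s ^ 2) 0 *
        Real.exp (-(y ^ 2 / (2 * (1 + (s : ℝ) ^ 2)))) *
        Real.exp (-(1 / (2 * ((s : ℝ) ^ 2 / (1 + (s : ℝ) ^ 2)))) *
          (x - y / (1 + (s : ℝ) ^ 2)) ^ 2) := by
  have hs' : (s : ℝ) ≠ 0 := by exact_mod_cast hs
  have h1 : (1 + (s : ℝ) ^ 2) ≠ 0 := by positivity
  simp only [gaussianPDFReal]
  have : Real.exp (-(x - 0) ^ 2 / (2 * ((1 : ℝ≥0) : ℝ))) *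
      Real.exp (-(y - x) ^ 2 / (2 * ((s ^ 2 : ℝ≥0) : ℝ))) =
      Real.exp (-(y ^ 2 / (2 * (1 + (s : ℝ) ^ 2)))) *
        Real.exp (-(1 / (2 * ((s : ℝ) ^ 2 / (1 + (s : ℝ) ^ 2)))) *
          (x - y / (1 + (s : ℝ) ^ 2)) ^ 2) := by
    rw [← Real.exp_add, ← Real.exp_add]
    congr 1
    push_cast
    field_simp
    ring
  simp only [sub_zero, mul_one, zero_pow, ne_eq, OfNat.ofNat_ne_zero, not_false_eq_true, neg_zero,
    zero_div, Real.exp_zero] at this ⊢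
  linear_combination (√(2 * Real.pi * ((1 : ℝ≥0) : ℝ)))⁻¹ *
    (√(2 * Real.pi * ((s ^ 2 : ℝ≥0) : ℝ)))⁻¹ * this

theorem lintegral_posterior_le {s : ℝ≥0} (hs : s ≠ 0) (y : ℝ) :
    ∫⁻ x in Ioi 0, 2 * gaussianPDF 0 1 x * (gaussianPDF x (s ^ 2) y * ENNReal.ofReal x) ≤
    ∫⁻ x in Ioi 0, 2 * gaussianPDF 0 1 x *
      (gaussianPDF x (s ^ 2) y * ENNReal.ofReal (posteriorBound s y)) := by
  have hs' : 0 < (s : ℝ) := by exact_mod_cast pos_iff_ne_zero.2 hs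
  set v : ℝ := (s : ℝ) ^ 2 / (1 + (s : ℝ) ^ 2) with hv
  have hv0 : 0 < v := by positivity
  have hv1 : v ≤ 1 := by rw [hv, div_le_one (by positivity)]; linarith
  set μ : ℝ := y / (1 + (s : ℝ) ^ 2) with hμ
  set C : ℝ := gaussianPDFReal 0 1 0 * gaussianPDFReal 0 (s ^ 2) 0 *
        Real.exp (-(y ^ 2 / (2 * (1 + (s : ℝ) ^ 2)))) with hC
  have hC0 : 0 ≤ C := by
    have := gaussianPDFReal_nonneg 0 1 0
    have := gaussianPDFReal_nonneg 0 (s ^ 2) 0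
    positivity
  have hrw : ∀ x z : ℝ, 0 ≤ z →
      2 * gaussianPDF 0 1 x * (gaussianPDF x (s ^ 2) y * ENNReal.ofReal z) =
      2 * ENNReal.ofReal C * ENNReal.ofReal (z * Real.exp (-(1 / (2 * v)) * (x - μ) ^ 2)) := by
    intro x z hz
    have h := gaussianPDFReal_mul_gaussianPDFReal hs x y
    rw [gaussianPDF, gaussianPDF, mul_assoc, mul_assoc, ← ENNReal.ofReal_mul hC0,
      ← ENNReal.ofReal_mul (gaussianPDFReal_nonneg _ _ _),
      ← ENNReal.ofReal_mul (gaussianPDFReal_nonneg _ _ _), ← mul_assoc, h]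
    congr 2
    ring
  have hh := one_le_posteriorBound s y
  rw [setLIntegral_congr_fun measurableSet_Ioi fun x (hx : 0 < x) => hrw x x hx.le,
    setLIntegral_congr_fun measurableSet_Ioi fun x _ => hrw x (posteriorBound s y) (by linarith),
    lintegral_const_mul' _ _ (by finiteness), lintegral_const_mul' _ _ (by finiteness)]
  refine mul_le_mul_right ?_ (2 * ENNReal.ofReal C)
  have hi1 : IntegrableOn (fun x => x * Real.exp (-(1 / (2 * v)) * (x - μ) ^ 2)) (Ioi 0) := by
    simpa using (integrable_sub_mul_gaussian hv0 μ 0).integrableOn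
  have hi2 : IntegrableOn (fun x => posteriorBound s y *
      Real.exp (-(1 / (2 * v)) * (x - μ) ^ 2)) (Ioi 0) :=
    (((integrable_exp_neg_mul_sq (by positivity : 0 < 1 / (2 * v))).comp_sub_right
      μ).const_mul _).integrableOn
  rw [← ofReal_integral_eq_lintegral_ofReal hi1 ((ae_restrict_mem measurableSet_Ioi).mono
      fun x (hx : 0 < x) => mul_nonneg hx.le (Real.exp_pos _).le),
    ← ofReal_integral_eq_lintegral_ofReal hi2 (ae_of_all _ fun x =>
      mul_nonneg (by linarith) (Real.exp_pos _).le)]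
  refine ENNReal.ofReal_le_ofReal (sub_nonpos.1 ?_)
  rw [← integral_sub hi1 hi2]
  simp only [← sub_mul]
  exact integral_Ioi_sub_mul_gaussian_le hv0 hv1 μ

/-- Tonelli for the joint density of `(X, Y)`, which exists only for nonzero noise. -/
theorem lintegral_boxLaw_halfNormal {s : ℝ≥0} (hs : s ≠ 0) {A : Set ℝ} (hA : MeasurableSet A)
    {F : ℝ → ℝ → ℝ≥0∞} (hF : Measurable (Function.uncurry F)) :
    ∫⁻ p in (fun p : ℝ × ℝ => p.1 + p.2) ⁻¹' A, F p.1 (p.1 + p.2) ∂(boxLaw halfNormal s) =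
      ∫⁻ y in A, ∫⁻ x in Ioi 0, 2 * gaussianPDF 0 1 x * (gaussianPDF x (s ^ 2) y * F x y) := by
  have hA' : MeasurableSet ((fun p : ℝ × ℝ => p.1 + p.2) ⁻¹' A) := hA.preimage (by fun_prop)
  have hg : Measurable (Function.uncurry fun x y => gaussianPDF x (s ^ 2) y) := by
    simp only [gaussianPDF, gaussianPDFReal, Function.uncurry_def]
    fun_prop
  have hG : Measurable fun p : ℝ × ℝ => A.indicator (F p.1) p.2 := by
    have : (fun p : ℝ × ℝ => A.indicator (F p.1) p.2) =
        (Prod.snd ⁻¹' A).indicator (Function.uncurry F) := by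
      rfl
    rw [this]
    exact hF.indicator (hA.preimage measurable_snd)
  have h1 : ∀ x, ∫⁻ e, A.indicator (F x) (x + e) ∂(gaussianReal 0 (s ^ 2)) =
      ∫⁻ y in A, gaussianPDF x (s ^ 2) y * F x y := by
    intro x
    have hGx : Measurable (A.indicator (F x)) := hG.comp measurable_prodMk_left
    rw [← lintegral_map (f := A.indicator (F x)) hGx (measurable_const_add x),
      gaussianReal_map_const_add, zero_add, gaussianReal_of_var_ne_zero _ (pow_ne_zero 2 hs),
      lintegral_withDensity_eq_lintegral_mul _ (measurable_gaussianPDF _ _) hGx,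
      ← lintegral_indicator hA]
    refine lintegral_congr fun y => ?_
    by_cases hy : y ∈ A <;> simp [hy]
  rw [← lintegral_indicator hA', boxLaw]
  have h2 : ((fun p : ℝ × ℝ => p.1 + p.2) ⁻¹' A).indicator (fun p => F p.1 (p.1 + p.2)) =
      fun p : ℝ × ℝ => A.indicator (F p.1) (p.1 + p.2) := by
    rfl
  have hm : Measurable fun p : ℝ × ℝ => A.indicator (F p.1) (p.1 + p.2) :=
    hG.comp (measurable_fst.prodMk (measurable_fst.add measurable_snd))
  rw [h2, lintegral_prod _ hm.aemeasurable]
  simp only [h1]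
  have hgF : Measurable (Function.uncurry fun x y => gaussianPDF x (s ^ 2) y * F x y) :=
    hg.mul hF
  rw [lintegral_halfNormal hgF.lintegral_prod_right]
  have h3 : ∀ x, 2 * gaussianPDF 0 1 x * ∫⁻ y in A, gaussianPDF x (s ^ 2) y * F x y =
      ∫⁻ y in A, 2 * gaussianPDF 0 1 x * (gaussianPDF x (s ^ 2) y * F x y) := fun x =>
    (lintegral_const_mul' _ _ (ENNReal.mul_ne_top (by simp) gaussianPDF_lt_top.ne)).symm
  simp only [h3]
  refine lintegral_lintegral_swap (Measurable.aemeasurable ?_)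
  exact (((measurable_gaussianPDF 0 1).comp measurable_fst).const_mul 2).mul hgF

theorem setLIntegral_boxLaw_le (s : ℝ≥0) {A : Set ℝ} (hA : MeasurableSet A) :
    ∫⁻ p in (fun p : ℝ × ℝ => p.1 + p.2) ⁻¹' A, ENNReal.ofReal p.1 ∂(boxLaw halfNormal s) ≤
      ∫⁻ p in (fun p : ℝ × ℝ => p.1 + p.2) ⁻¹' A, ENNReal.ofReal (posteriorBound s (p.1 + p.2))
        ∂(boxLaw halfNormal s) := by
  rcases eq_or_ne s 0 with rfl | hs
  -- Without noise `Y = X`, and the bound is `1 + max x 0 ≥ x`.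
  · have h0 : ∀ᵐ p ∂(boxLaw halfNormal 0), p.2 = 0 := by
      have : ∀ᵐ e ∂(gaussianReal 0 ((0 : ℝ≥0) ^ 2)), e = 0 := by
        simp
      exact Measure.quasiMeasurePreserving_snd.ae this
    refine lintegral_mono_ae (ae_restrict_of_ae (h0.mono fun p hp => ?_))
    refine ENNReal.ofReal_le_ofReal ?_
    simp only [posteriorBound, hp]
    norm_num
    linarith [le_max_left p.1 0]
  · have hm := measurable_posteriorBound s
    rw [lintegral_boxLaw_halfNormal hs hA (F := fun x _ => ENNReal.ofReal x)
        (by simp only [Function.uncurry_def]; fun_prop),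
      lintegral_boxLaw_halfNormal hs hA (F := fun _ y => ENNReal.ofReal (posteriorBound s y))
        (by simp only [Function.uncurry_def]; fun_prop)]
    exact lintegral_mono fun y => lintegral_posterior_le hs y

/-- Conditional expectations are determined by integrals over events `Y ∈ A`, so the bound is
checked there, on the joint law. Positive parts keep everything in `ℝ≥0∞`. -/
theorem posteriorMean_le_ae (s : ℝ≥0) :
    ∀ᵐ y ∂(obsLaw halfNormal s), posteriorMean halfNormal s y ≤ posteriorBound s y := by
  set κ := condDistrib (fun p : ℝ × ℝ => p.1) (fun p : ℝ × ℝ => p.1 + p.2) (boxLaw halfNormal s)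
    with hκ
  have hcomp : (obsLaw halfNormal s) ⊗ₘ κ =
      (boxLaw halfNormal s).map fun p : ℝ × ℝ => (p.1 + p.2, p.1) :=
    compProd_map_condDistrib (by fun_prop)
  have hm := measurable_posteriorBound s
  have hP : Measurable fun y => ∫⁻ x, ENNReal.ofReal x ∂(κ y) :=
    Measurable.lintegral_kernel (by fun_prop)
  have h : (fun y => ∫⁻ x, ENNReal.ofReal x ∂(κ y)) ≤ᵐ[obsLaw halfNormal s]
      fun y => ENNReal.ofReal (posteriorBound s y) := by
    refine ae_le_of_forall_setLIntegral_le_of_sigmaFinite hP fun A hA _ => ?_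
    have h1 : ∫⁻ y in A, ∫⁻ x, ENNReal.ofReal x ∂(κ y) ∂(obsLaw halfNormal s) =
        ∫⁻ p in (fun p : ℝ × ℝ => p.1 + p.2) ⁻¹' A, ENNReal.ofReal p.1 ∂(boxLaw halfNormal s) := by
      have hu := Measure.setLIntegral_compProd (μ := obsLaw halfNormal s) (κ := κ)
        (f := fun p : ℝ × ℝ => ENNReal.ofReal p.2) (by fun_prop) hA MeasurableSet.univ
      simp only [Measure.restrict_univ] at hu
      rw [← hu, hcomp, setLIntegral_map (hA.prod MeasurableSet.univ) (by fun_prop) (by fun_prop)]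
      congr 2
      ext p; simp
    have h2 : ∫⁻ y in A, ENNReal.ofReal (posteriorBound s y) ∂(obsLaw halfNormal s) =
        ∫⁻ p in (fun p : ℝ × ℝ => p.1 + p.2) ⁻¹' A, ENNReal.ofReal (posteriorBound s (p.1 + p.2))
        ∂(boxLaw halfNormal s) := by
      rw [obsLaw, setLIntegral_map hA (by fun_prop) (by fun_prop)]
    rw [h1, h2]
    exact setLIntegral_boxLaw_le s hA
  filter_upwards [h] with y hy
  have hb := one_le_posteriorBound s y
  rw [posteriorMean]
  by_cases hi : Integrable (fun x : ℝ => x) (κ y)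
  · rw [integral_eq_lintegral_pos_part_sub_lintegral_neg_part hi]
    have := ENNReal.toReal_mono ENNReal.ofReal_ne_top hy
    rw [ENNReal.toReal_ofReal (by linarith)] at this
    have h0 := ENNReal.toReal_nonneg (a := ∫⁻ x, ENNReal.ofReal (-x) ∂(κ y))
    linarith
  -- The default value `0` of the integral also lies below the bound.
  · rw [integral_undef hi]
    linarith

theorem integrable_fst_boxLaw_halfNormal (s : ℝ≥0) :
    Integrable (fun p : ℝ × ℝ => p.1) (boxLaw halfNormal s) :=
  integrable_id_halfNormal.comp_fst _

theorem integrable_posteriorMean (s : ℝ≥0) :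
    Integrable (posteriorMean halfNormal s) (obsLaw halfNormal s) := by
  refine Integrable.integral_condDistrib_map (f := fun p : ℝ × ℝ => p.2) (by fun_prop) ?_
  rw [integrable_map_measure (by fun_prop) (by fun_prop)]
  exact integrable_fst_boxLaw_halfNormal s

/-- The tower property. -/
theorem integral_posteriorMean (s : ℝ≥0) :
    ∫ y, posteriorMean halfNormal s y ∂(obsLaw halfNormal s) = mean halfNormal := by
  have hcomp : (obsLaw halfNormal s) ⊗ₘ condDistrib (fun p : ℝ × ℝ => p.1)
      (fun p : ℝ × ℝ => p.1 + p.2) (boxLaw halfNormal s) =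
      (boxLaw halfNormal s).map fun p : ℝ × ℝ => (p.1 + p.2, p.1) :=
    compProd_map_condDistrib (by fun_prop)
  have hint : Integrable (fun p : ℝ × ℝ => p.2)
      ((boxLaw halfNormal s).map fun p : ℝ × ℝ => (p.1 + p.2, p.1)) := by
    rw [integrable_map_measure (by fun_prop) (by fun_prop)]
    exact integrable_fst_boxLaw_halfNormal s
  have h := Measure.integral_compProd (hcomp ▸ hint)
  rw [hcomp, integral_map (by fun_prop) (by fun_prop)] at h
  simp only [posteriorMean]
  rw [← h, boxLaw]
  refine (integral_fun_fst (fun x : ℝ => x)).trans ?_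
  simp [mean]

/-! ### Exponential moments of the observations -/

theorem integrable_exp_mul_obsLaw (s : ℝ≥0) (θ : ℝ) :
    Integrable (fun y => Real.exp (θ * y)) (obsLaw halfNormal s) := by
  rw [obsLaw, integrable_map_measure (by fun_prop) (by fun_prop)]
  refine ((integrable_exp_mul_halfNormal θ).mul_prod
    (integrable_exp_mul_gaussianReal (μ := 0) (v := s ^ 2) θ)).congr (ae_of_all _ fun p => ?_)
  simp [mul_add, Real.exp_add]

theorem integral_exp_mul_obsLaw_le (s : ℝ≥0) (θ : ℝ) :
    ∫ y, Real.exp (θ * y) ∂(obsLaw halfNormal s) ≤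
      2 * Real.exp (θ ^ 2 * (1 + (s : ℝ) ^ 2) / 2) := by
  rw [obsLaw, integral_map (by fun_prop) (by fun_prop)]
  simp only [mul_add, Real.exp_add]
  rw [boxLaw, integral_prod_mul (fun x => Real.exp (θ * x)) (fun x => Real.exp (θ * x)),
    integral_exp_mul_gaussianReal]
  calc _ ≤ 2 * Real.exp (θ ^ 2 / 2) * Real.exp (((s ^ 2 : ℝ≥0) : ℝ) * θ ^ 2 / 2) :=
        mul_le_mul_of_nonneg_right (integral_exp_mul_halfNormal_le θ) (Real.exp_pos _).le
    _ = _ := by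
        rw [mul_assoc, ← Real.exp_add]
        push_cast
        ring_nf

theorem exp_mul_max_zero_le {l : ℝ} (z : ℝ) :
    Real.exp (l * max z 0) ≤ 1 + Real.exp (l * z) := by
  rcases max_choice z 0 with h | h <;> rw [h]
  · linarith
  · simp [Real.exp_nonneg]

theorem integrable_exp_mul_max_obsLaw (s : ℝ≥0) (l : ℝ) :
    Integrable (fun y => Real.exp (l * max (y / (1 + (s : ℝ) ^ 2)) 0)) (obsLaw halfNormal s) := by
  refine ((integrable_const (1 : ℝ)).add
    (integrable_exp_mul_obsLaw s (l / (1 + (s : ℝ) ^ 2)))).mono' (by fun_prop)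
    (ae_of_all _ fun y => ?_)
  rw [Real.norm_of_nonneg (Real.exp_pos _).le]
  refine (exp_mul_max_zero_le _).trans (le_of_eq ?_)
  simp only [Pi.add_apply]
  ring_nf

/-- Tilting `Y` by `θ = l/(1+s²)` turns the variance proxy `1+s²` into `1/(1+s²)`. The positive part
costs an extra `1`, absorbed by raising the factor 2 to 3. -/
theorem integral_exp_mul_max_obsLaw_le (s : ℝ≥0) (l : ℝ) :
    ∫ y, Real.exp (l * max (y / (1 + (s : ℝ) ^ 2)) 0) ∂(obsLaw halfNormal s) ≤
      3 * Real.exp (l ^ 2 / (1 + (s : ℝ) ^ 2) / 2) := by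
  have h1 : (0 : ℝ) < 1 + (s : ℝ) ^ 2 := by positivity
  have hi := integrable_exp_mul_obsLaw s (l / (1 + (s : ℝ) ^ 2))
  have h2 : ∫ y, Real.exp (l * max (y / (1 + (s : ℝ) ^ 2)) 0) ∂(obsLaw halfNormal s) ≤
      ∫ y, (1 + Real.exp (l / (1 + (s : ℝ) ^ 2) * y)) ∂(obsLaw halfNormal s) := by
    refine integral_mono (integrable_exp_mul_max_obsLaw s l) ((integrable_const 1).add hi)
      fun y => (exp_mul_max_zero_le _).trans (le_of_eq ?_)
    ring_nf
  rw [integral_add (integrable_const _) hi] at h2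
  have h3 := integral_exp_mul_obsLaw_le s (l / (1 + (s : ℝ) ^ 2))
  have h4 : (l / (1 + (s : ℝ) ^ 2)) ^ 2 * (1 + (s : ℝ) ^ 2) / 2 = l ^ 2 / (1 + (s : ℝ) ^ 2) / 2 := by
    field_simp
  rw [h4] at h3
  have h5 : 1 ≤ Real.exp (l ^ 2 / (1 + (s : ℝ) ^ 2) / 2) := Real.one_le_exp (by positivity)
  simp only [integral_const, probReal_univ, smul_eq_mul, one_mul] at h2
  linarith

/-- This is `w + 1 ≤ exp w` at `w = l z - 2 log N`: a threshold plus an exponential overshoot with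
small weight. -/
theorem le_log_add_exp {l N : ℝ} (hl : 0 < l) (hN : 0 < N) (z : ℝ) :
    z ≤ 2 * Real.log N / l + Real.exp (l * z) / (N ^ 2 * l) := by
  have h := Real.add_one_le_exp (l * z - 2 * Real.log N)
  rw [Real.exp_sub, two_mul, Real.exp_add, Real.exp_log hN, ← sq] at h
  have h2 : 2 * Real.log N / l + Real.exp (l * z) / (N ^ 2 * l) =
      (2 * Real.log N + Real.exp (l * z) / N ^ 2) / l := by
    field_simp
  rw [h2, le_div_iff₀ hl]
  linarith

/-! ### The union bound and the two groups of boxes -/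

/-- A union bound for the optimal reward, with one exponential tilt `l i` for each box. -/
theorem optReward_halfNormal_le {n : ℕ} (hn : n ≠ 0) (σ : Fin n → ℝ≥0) {l N : Fin n → ℝ} {T : ℝ}
    (hl : ∀ i, 0 < l i) (hN : ∀ i, 1 ≤ N i)
    (hlN : ∀ i, l i ^ 2 / (1 + (σ i : ℝ) ^ 2) ≤ Real.log (N i))
    (hT : ∀ i, 2 * Real.log (N i) / l i ≤ T) :
    optReward halfNormal σ ≤ 1 + T + ∑ i, 3 / (N i * l i) := by
  have hne : Nonempty (Fin n) := ⟨⟨0, Nat.pos_of_ne_zero hn⟩⟩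
  let g : Fin n → ℝ → ℝ := fun i y =>
    Real.exp (l i * max (y / (1 + (σ i : ℝ) ^ 2)) 0) / (N i ^ 2 * l i)
  have hg0 : ∀ i y, 0 ≤ g i y := fun i y => by
    have := hl i
    positivity
  have hgi : ∀ i, Integrable (g i) (obsLaw halfNormal (σ i)) := fun i =>
    (integrable_exp_mul_max_obsLaw (σ i) (l i)).div_const _
  have hgle : ∀ i, ∫ y, g i y ∂(obsLaw halfNormal (σ i)) ≤ 3 / (N i * l i) := by
    intro i
    have hNi : 0 < N i := one_pos.trans_le (hN i)
    have hli := hl i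
    rw [integral_div, div_le_div_iff₀ (by positivity) (by positivity)]
    have h1 := integral_exp_mul_max_obsLaw_le (σ i) (l i)
    have h2 : Real.exp (l i ^ 2 / (1 + (σ i : ℝ) ^ 2) / 2) ≤ N i := by
      rw [← Real.le_log_iff_exp_le hNi]
      have := Real.log_nonneg (hN i)
      linarith [hlN i]
    calc _ ≤ (3 * N i) * (N i * l i) := by
          refine mul_le_mul_of_nonneg_right ?_ (by positivity)
          linarith
      _ = _ := by ring
  set P := Measure.pi fun i => obsLaw halfNormal (σ i) with hP
  have hgP : ∀ i, Integrable (fun y : Fin n → ℝ => g i (y i)) P := fun i =>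
    integrable_comp_eval (hgi i)
  have hae : ∀ᵐ y ∂P, ∀ i, posteriorMean halfNormal (σ i) (y i) ≤ posteriorBound (σ i) (y i) := by
    rw [ae_all_iff]
    exact fun i => (measurePreserving_eval (fun i => obsLaw halfNormal (σ i))
      i).quasiMeasurePreserving.ae (posteriorMean_le_ae (σ i))
  have hsum : Integrable (fun y : Fin n → ℝ => 1 + T + ∑ i, g i (y i)) P :=
    (integrable_const _).add (integrable_finsetSum _ fun i _ => hgP i)
  calc optReward halfNormal σ ≤ ∫ y, (1 + T + ∑ i, g i (y i)) ∂P := by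
        refine integral_mono_ae (integrable_fin_iSup fun i => integrable_posteriorMean (σ i))
          hsum (hae.mono fun y hy => ciSup_le fun i => (hy i).trans ?_)
        have h1 := le_log_add_exp (hl i) (one_pos.trans_le (hN i))
          (max (y i / (1 + (σ i : ℝ) ^ 2)) 0)
        have h2 := Finset.single_le_sum (f := fun i => g i (y i)) (fun i _ => hg0 i (y i))
          (Finset.mem_univ i)
        simp only [posteriorBound]
        have h3 := hT i
        change max _ 0 ≤ _ + g i (y i) at h1
        linarith
    _ = 1 + T + ∑ i, ∫ y, g i y ∂(obsLaw halfNormal (σ i)) := by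
        rw [integral_add (integrable_const _) (integrable_finsetSum _ fun i _ => hgP i),
          integral_finsetSum _ fun i _ => hgP i]
        congr 1
        · simp
        · exact Finset.sum_congr rfl fun i _ => integral_comp_eval (hgi i).aestronglyMeasurable
    _ ≤ _ := by gcongr with i; exact hgle i

theorem mean_le_optReward_halfNormal {n : ℕ} (hn : n ≠ 0) (σ : Fin n → ℝ≥0) :
    mean halfNormal ≤ optReward halfNormal σ := by
  let i : Fin n := ⟨0, Nat.pos_of_ne_zero hn⟩
  rw [← integral_posteriorMean (σ i), ← integral_comp_eval
    (μ := fun i => obsLaw halfNormal (σ i)) (integrable_posteriorMean (σ i)).aestronglyMeasurable]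
  exact integral_mono (integrable_comp_eval (integrable_posteriorMean (σ i)))
    (integrable_fin_iSup fun i => integrable_posteriorMean (σ i))
    fun y => le_ciSup (f := fun i => posteriorMean halfNormal (σ i) (y i))
      (Set.finite_range _).bddAbove i

theorem sum_inv_two_groups_le {n m : ℕ} (hn : n ≠ 0) (hm : m ≠ 0) :
    ∑ i : Fin n, 1 / (if (i : ℕ) + 1 < m then (m : ℝ) else n) ≤ 2 := by
  have hn' : (0 : ℝ) < n := by exact_mod_cast Nat.pos_of_ne_zero hn
  have hm' : (0 : ℝ) < m := by exact_mod_cast Nat.pos_of_ne_zero hm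
  have hcard : (Finset.univ.filter fun i : Fin n => (i : ℕ) + 1 < m).card ≤ m := by
    have := Finset.card_le_card_of_injOn (s := Finset.univ.filter fun i : Fin n => (i : ℕ) + 1 < m)
      (t := Finset.range m) (fun i => (i : ℕ)) (fun i hi => by
        have := (Finset.mem_filter.1 hi).2
        simp
        omega) (fun i _ j _ h => Fin.ext h)
    simpa using this
  calc ∑ i : Fin n, 1 / (if (i : ℕ) + 1 < m then (m : ℝ) else n)
      ≤ ∑ i : Fin n, ((if (i : ℕ) + 1 < m then 1 / (m : ℝ) else 0) + 1 / n) := by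
        refine Finset.sum_le_sum fun i _ => ?_
        split_ifs
        · have : 0 ≤ 1 / (n : ℝ) := by positivity
          linarith
        · simp
    _ ≤ 1 + 1 := by
        rw [Finset.sum_add_distrib, ← Finset.sum_filter]
        simp only [Finset.sum_const, nsmul_eq_mul, Finset.card_univ, Fintype.card_fin]
        gcongr
        · rw [mul_one_div, div_le_one hm']
          exact_mod_cast hcard
        · rw [mul_one_div_cancel hn'.ne']
    _ = 2 := by norm_num

theorem optReward_halfNormal_largeNoise_le : ∃ K : ℝ, 0 < K ∧ ∀ n : ℕ,
    ∀ c ∈ Icc (1 / (n : ℝ)) 1, c * n ∉ Ioo (1 : ℝ) 2 → ∀ σ ∈ largeNoise halfNormal n c,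
      optReward halfNormal σ ≤ K * √(Real.log (c * n)) := by
  obtain ⟨a, ha, hE⟩ := expMax_halfNormal_lower
  have hl2 : 0 < √(Real.log 2) := Real.sqrt_pos.2 (Real.log_pos one_lt_two)
  set r := √(Real.log 2) with hr
  -- The three summands pay for the three terms of the union bound: the constant `1`, the threshold
  -- `T` and the sum of overshoots. Constants become multiples of `√L` through `r ≤ √L`.
  refine ⟨1 / r + (2 + 4 / a) + 6 / r / r, by positivity, ?_⟩
  rintro n c ⟨-, hc1⟩ hcn σ ⟨hmono, hcn1, i₀, hi₀, hlt⟩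
  have hcn2 : 2 ≤ c * n := by
    by_contra h
    exact hcn ⟨hcn1, not_le.1 h⟩
  have hn0 : n ≠ 0 := by rintro rfl; simp at hcn2; linarith
  set L := Real.log (c * n) with hL
  set m := ⌊c * n⌋₊ with hm
  have hm2 : 2 ≤ m := Nat.le_floor (by exact_mod_cast hcn2)
  have hm2' : (2 : ℝ) ≤ m := by exact_mod_cast hm2
  have hmle : (m : ℝ) ≤ c * n := Nat.floor_le (by linarith)
  have hcnn : c * n ≤ n := mul_le_of_le_one_left (Nat.cast_nonneg n) hc1
  have hn2 : (2 : ℝ) ≤ n := hcn2.trans hcnn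
  have hmL : Real.log m ≤ L := Real.log_le_log (by linarith) hmle
  have hLm : L ≤ 2 * Real.log m := by
    rw [← Nat.cast_ofNat, ← Real.log_pow]
    -- Here `cn < m + 1 ≤ m²`, as `m ≥ 2`.
    refine Real.log_le_log (by linarith) ?_
    have : c * n < m + 1 := Nat.lt_floor_add_one _
    nlinarith
  have hlogm : Real.log 2 ≤ Real.log m := Real.log_le_log two_pos hm2'
  have hlogn : Real.log 2 ≤ Real.log n := Real.log_le_log two_pos hn2
  have h2pos : 0 < Real.log 2 := Real.log_pos one_lt_two
  have hLpos : 0 < L := by linarith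
  set t := expMax halfNormal m * √(Real.log n) / L with ht
  have hEm : a * √(Real.log m) ≤ expMax halfNormal m := hE m (by omega)
  have hEpos : 0 < expMax halfNormal m :=
    (mul_pos ha (Real.sqrt_pos.2 (by linarith))).trans_le hEm
  have ht0 : 0 ≤ t := by positivity
  have hsL : √L ≤ 2 * √(Real.log m) := by
    rw [show (2 : ℝ) = √4 by rw [show (4 : ℝ) = 2 ^ 2 by norm_num]; simp, ← Real.sqrt_mul (by norm_num)]
    exact Real.sqrt_le_sqrt (by linarith)
  have hrL : r ≤ √L := Real.sqrt_le_sqrt (by linarith)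
  -- Indices start at 0, so the box `i₀` with `i₀ + 1 = m` already belongs to the noisy group. There
  -- `σ i ≥ t` permits a tilt larger by the factor `√(1 + t²)`.
  let N : Fin n → ℝ := fun i => if (i : ℕ) + 1 < m then (m : ℝ) else n
  let l : Fin n → ℝ := fun i =>
    if (i : ℕ) + 1 < m then √(Real.log m) else √((1 + t ^ 2) * Real.log n)
  have hrl : ∀ i, r ≤ l i := by
    intro i
    dsimp only [l]
    split_ifs
    · exact Real.sqrt_le_sqrt hlogm
    · exact Real.sqrt_le_sqrt (by nlinarith [sq_nonneg t])
  have hl : ∀ i, 0 < l i := fun i => hl2.trans_le (hrl i)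
  have hN : ∀ i, 1 ≤ N i := by
    intro i
    dsimp only [N]
    split_ifs <;> linarith
  have hlN : ∀ i, l i ^ 2 / (1 + (σ i : ℝ) ^ 2) ≤ Real.log (N i) := by
    intro i
    have hs : (0 : ℝ) ≤ (σ i : ℝ) ^ 2 := by positivity
    rw [div_le_iff₀ (by positivity)]
    dsimp only [l, N]
    split_ifs with hi
    · rw [Real.sq_sqrt (by linarith)]
      nlinarith
    · rw [Real.sq_sqrt (by positivity), mul_comm]
      have h1 : i₀ ≤ i := by
        rw [Fin.le_def]
        omega
      have h2 : (σ i₀ : ℝ) ≤ σ i := by exact_mod_cast hmono h1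
      have h3 : t ≤ σ i := hlt.le.trans h2
      gcongr
  have hT : ∀ i, 2 * Real.log (N i) / l i ≤ (2 + 4 / a) * √L := by
    intro i
    have h4 : 0 ≤ 4 / a := by positivity
    rw [div_le_iff₀ (hl i)]
    dsimp only [l, N]
    split_ifs with hi
    · have h5 : √(Real.log m) ≤ √L := Real.sqrt_le_sqrt hmL
      have h6 : Real.log m = √(Real.log m) * √(Real.log m) := (Real.mul_self_sqrt (by linarith)).symm
      have h7 := Real.sqrt_nonneg (Real.log m)
      calc 2 * Real.log m = 2 * √(Real.log m) * √(Real.log m) := by linarith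
        _ ≤ _ := by gcongr; linarith
    · have h5 : t * √(Real.log n) ≤ √((1 + t ^ 2) * Real.log n) := by
        refine Real.le_sqrt_of_sq_le ?_
        rw [mul_pow, Real.sq_sqrt (by linarith)]
        nlinarith
      have h6 : t * √(Real.log n) = expMax halfNormal m * Real.log n / L := by
        rw [ht, div_mul_eq_mul_div, mul_assoc, Real.mul_self_sqrt (by linarith)]
      have h7 : L ≤ 2 / a * √L * expMax halfNormal m := by
        calc L = √L * √L := (Real.mul_self_sqrt hLpos.le).symm
          _ ≤ √L * (2 * √(Real.log m)) := by gcongr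
          _ = 2 / a * √L * (a * √(Real.log m)) := by field_simp
          _ ≤ _ := by gcongr
      calc 2 * Real.log n = 2 * Real.log n * L / L := by field_simp
        _ ≤ 2 * Real.log n * (2 / a * √L * expMax halfNormal m) / L := by
            have : 0 ≤ Real.log n := by linarith
            gcongr
        _ = 4 / a * √L * (t * √(Real.log n)) := by rw [h6]; ring
        _ ≤ _ := by gcongr; linarith
  have hsum : ∑ i, 3 / (N i * l i) ≤ 6 / r := by
    calc ∑ i, 3 / (N i * l i) ≤ ∑ i, 3 / r * (1 / N i) := by
          refine Finset.sum_le_sum fun i _ => ?_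
          have := hN i
          rw [div_mul_div_comm, mul_one, mul_comm r]
          have := hrl i
          gcongr
      _ = 3 / r * ∑ i, 1 / N i := by rw [Finset.mul_sum]
      _ ≤ 3 / r * 2 := by
          gcongr
          exact sum_inv_two_groups_le hn0 (by omega)
      _ = 6 / r := by ring
  have hmain := optReward_halfNormal_le hn0 σ hl hN hlN hT
  have hA : 1 ≤ 1 / r * √L := by
    rw [one_div_mul_eq_div, one_le_div hl2]; exact hrL
  have hB : 6 / r ≤ 6 / r / r * √L := by
    calc 6 / r = 6 / r * 1 := by ring
      _ ≤ 6 / r * (1 / r * √L) := by gcongr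
      _ = _ := by ring
  linarith

theorem mainTheorem6 :
    IsMHR halfNormal ∧
    (fun _ : ℕ => mean halfNormal) =o[atTop] (fun k : ℕ => expMax halfNormal k) ∧
    ∃ n₀ : ℕ,
      (∃ K : ℝ, 0 < K ∧ ∀ n : ℕ, n₀ ≤ n → ∀ c ∈ Icc (1 / (n : ℝ)) 1, c * n ∉ Ioo (1 : ℝ) 2 →
        ∀ σ ∈ largeNoise halfNormal n c,
          optReward halfNormal σ ≤ K * (√(Real.log (c * n)) * mean halfNormal)) ∧
      (∀ M : ℝ, ∃ K : ℝ, 0 < K ∧ ∀ n : ℕ, n₀ ≤ n → ∀ c ∈ Icc (1 / (n : ℝ)) 1,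
        c * n ∉ Ioo (1 : ℝ) 2 → c * n ≤ M → ∀ σ ∈ largeNoise halfNormal n c,
          randomReward halfNormal n ≤ optReward halfNormal σ ∧
          optReward halfNormal σ ≤ K * randomReward halfNormal n) := by
  obtain ⟨K, hK, h⟩ := optReward_halfNormal_largeNoise_le
  have hmean := mean_halfNormal_pos
  refine ⟨isMHR_halfNormal, mean_isLittleO_expMax_halfNormal, 0, ⟨K / mean halfNormal,
    by positivity, fun n _ c hc hcn σ hσ => (h n c hc hcn σ hσ).trans_eq (by field_simp)⟩,
    -- The `+ 1` keeps the constant positive even when `√(Real.log M) = 0`.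
    fun M => ⟨K * (√(Real.log M) + 1) / mean halfNormal, by positivity,
      fun n _ c hc hcn hM σ hσ => ?_⟩⟩
  have hcn1 : 1 < c * n := hσ.2.1
  have hn : n ≠ 0 := by rintro rfl; simp at hcn1; linarith
  rw [randomReward_eq_mean integrable_id_halfNormal hn]
  refine ⟨mean_le_optReward_halfNormal hn σ, (h n c hc hcn σ hσ).trans ?_⟩
  rw [div_mul_cancel₀ _ hmean.ne']
  have : √(Real.log (c * n)) ≤ √(Real.log M) :=
    Real.sqrt_le_sqrt (Real.log_le_log (by linarith) hM)
  gcongr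
  linarith
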